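/- Let $d\ge 1$, let $G=(V,E)$ be a finite simple graph, let $u,v\in V$, and let $V_0\subseteq V$ be such that $u,v\in V_0$ and the induced subgraph $G[V_0]$ is rigid in $\mathbb{R}^d$ (that is, $G[V_0]$ is a $(u,v)$-rigid subgraph of $G$). Let $e=s_1s_2\in E$ be an edge of $G$ that is not an edge of $G[V_0]$, i.e. $s_1$ and $s_2$ are not both in $V_0$. Let $G/e$ be the simple graph obtained from $G$ by identifying $s_1$ and $s_2$ and removing the loops and parallel edges that arise. If $\{u,v\}$ is weakly globally linked in $G/e$ in $\mathbb{R}^d$ (where $u,v$ denote also their images in $G/e$), then $\{u,v\}$ is weakly globally linked in $G$ in $\mathbb{R}^d$. Here a framework $(H,p)$ is a graph $H$ with a map $p:V(H)\to\mathbb{R}^d$; it is generic if its $d|V(H)|$ vertex coordinates are algebraically independent over $\mathbb{Q}$. Frameworks $(H,p)$ and $(H,q)$ are equivalent if $\|p(x)-p(y)\|=\|q(x)-q(y)\|$ (Euclidean norm) for all edges $xy$ of $H$, and congruent if this holds for all $x,y\in V(H)$. The framework $(H,p)$ is rigid if there is $\varepsilon>0$ such that every $(H,q)$ equivalent to $(H,p)$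 with $\|p(x)-q(x)\|<\varepsilon$ for all $x\in V(H)$ is congruent to $(H,p)$; the graph $H$ is rigid in $\mathbb{R}^d$ if every generic framework $(H,p)$ in $\mathbb{R}^d$ is rigid. The pair $\{u,v\}$ is globally linked in $(H,p)$ if $\|p(u)-p(v)\|=\|q(u)-q(v)\|$ for every $(H,q)$ in $\mathbb{R}^d$ equivalent to $(H,p)$, and it is weakly globally linked in $H$ in $\mathbb{R}^d$ if it is globally linked in some generic framework $(H,p)$ in $\mathbb{R}^d$. -/

import Mathlib

namespace GraphRigidity

/-- A `d`-dimensional configuration of `V`; a framework is a graph on `V` with such a map. -/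
abbrev Config (V : Type*) (d : ℕ) := V → EuclideanSpace ℝ (Fin d)

section

variable {V : Type*} {d : ℕ}

/-- The `d|V|` vertex coordinates are algebraically independent over `ℚ`. -/
def Generic (p : Config V d) : Prop :=
  AlgebraicIndependent ℚ (fun c : V × Fin d => p c.1 c.2)

/-- The frameworks `(G, p)` and `(G, q)` have the same edge lengths. -/
def Equivalent (G : SimpleGraph V) (p q : Config V d) : Prop :=
  ∀ x y : V, G.Adj x y → ‖p x - p y‖ = ‖q x - q y‖

/-- The configurations `p` and `q` have the same pairwise distances. -/
def Congruent (p q : Config V d) : Prop :=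
  ∀ x y : V, ‖p x - p y‖ = ‖q x - q y‖

/-- The framework `(G, p)` is rigid: every equivalent framework close to it is congruent to it. -/
def RigidFramework (G : SimpleGraph V) (p : Config V d) : Prop :=
  ∃ ε : ℝ, 0 < ε ∧ ∀ q : Config V d,
    Equivalent G p q → (∀ x : V, ‖p x - q x‖ < ε) → Congruent p q

/-- `G` is rigid in `ℝ^d`: every generic realization of `G` in `ℝ^d` is rigid. -/
def Rigid (d : ℕ) (G : SimpleGraph V) : Prop :=
  ∀ p : Config V d, Generic p → RigidFramework G p

/-- The induced subgraph `G[X]` is `(u,v)`-rigid in `ℝ^d`. -/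
def PairRigid (d : ℕ) (G : SimpleGraph V) (X : Set V) (u v : V) : Prop :=
  Rigid d (G.induce X) ∧ u ∈ X ∧ v ∈ X

/-- `{u,v}` is globally linked in the framework `(G, p)`. -/
def GloballyLinkedIn (G : SimpleGraph V) (p : Config V d) (u v : V) : Prop :=
  ∀ q : Config V d, Equivalent G p q → ‖p u - p v‖ = ‖q u - q v‖

/-- `{u,v}` is weakly globally linked in `G` in `ℝ^d`. -/
def WeaklyGloballyLinked (d : ℕ) (G : SimpleGraph V) (u v : V) : Prop :=
  ∃ p : Config V d, Generic p ∧ GloballyLinkedIn G p u v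

/-- The equivalence relation on `V` that identifies all elements of `S` and nothing else. -/
def contractSetoid (S : Set V) : Setoid V where
  r x y := x = y ∨ (x ∈ S ∧ y ∈ S)
  iseqv :=
    { refl := fun _ => Or.inl rfl
      symm := by
        rintro x y (h | ⟨hx, hy⟩)
        · exact Or.inl h.symm
        · exact Or.inr ⟨hy, hx⟩
      trans := by
        rintro x y z (rfl | ⟨hx, hy⟩) (rfl | ⟨hy', hz⟩)
        · exact Or.inl rfl
        · exact Or.inr ⟨hy', hz⟩
        · exact Or.inr ⟨hx, hy⟩
        · exact Or.inr ⟨hx, hz⟩ }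

/-- The vertex set of `G/S`. -/
abbrev ContractVertex (S : Set V) : Type _ := Quotient (contractSetoid S)

/-- The vertex of `G/S` that a vertex of `G` becomes. -/
def contractMk (S : Set V) (x : V) : ContractVertex S := Quotient.mk (contractSetoid S) x

/-- The contraction `G/S`: the elements of `S` are identified, loops and parallel edges removed. -/
def contract (G : SimpleGraph V) (S : Set V) : SimpleGraph (ContractVertex S) :=
  G.map (contractMk S)

end

end GraphRigidity

/-!
Pull a generic framework of `G/e` in which `{u, v}` is globally linked back to a framework `(G, p)`
with `p s₁ = p s₂`. An equivalent framework also has `s₁` and `s₂` at the same place, so `{u, v}` is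
globally linked in `(G, p)`; and `p` is generic on `V₀`, which contains at most one of `s₁`, `s₂`.

As `G[V₀]` is rigid and `p` is generic on `V₀`, the squared distance of `u` and `v` is algebraic
over the squared edge lengths of `G[V₀]`: if it were not, it could be varied near `p` with those
lengths fixed, because a transcendence basis of the polynomial ring has an invertible Jacobian at
a generic point. Hence only finitely many distances of `u` and `v` occur in frameworks that
agree with `p` on the edges of `G[V₀]`. For each of them, the configurations having an equivalent
framework that realizes it form a closed set, which contains `p` only when it is `‖p u - p v‖`. So
`{u, v}` stays globally linked in `(G, p')` for every `p'` close to `p` that agrees with `p` on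
`V₀`, and such a `p'` can be chosen generic.
-/

open Filter Topology MvPolynomial

namespace GraphRigidity

section Derivation

variable {A B M : Type*} [CommRing A] [CommRing B] [IsDomain B] [CharZero B] [Algebra A B]
  [AddCommGroup M] [Module A M] [Module B M] [Module.IsTorsionFree B M]

theorem derivation_eq_zero_of_isAlgebraic [FaithfulSMul A B] (D : Derivation A B M) {x : B}
    (hx : IsAlgebraic A x) : D x = 0 := by
  by_contra hDx
  obtain ⟨Q, hQ, hQx⟩ := hx
  -- `x` is a root of every iterated derivative of `Q`, the last of which is a nonzero constant.
  have derivative_root (P : Polynomial A) (hP : Polynomial.aeval x P = 0) :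
      Polynomial.aeval x P.derivative = 0 := by
    have hDP := D.map_aeval P x
    rw [hP, map_zero] at hDP
    exact (smul_eq_zero.1 hDP.symm).resolve_right hDx
  have iterate_root (n : ℕ) : Polynomial.aeval x (Polynomial.derivative^[n] Q) = 0 := by
    induction n with
    | zero => exact hQx
    | succ n ih => exact Function.iterate_succ_apply' .. ▸ derivative_root _ ih
  have hlead := iterate_root Q.natDegree
  rw [Polynomial.eq_C_of_natDegree_eq_zero (p := Polynomial.derivative^[Q.natDegree] Q)
    (by simpa using Q.natDegree_iterate_derivative Q.natDegree), Polynomial.aeval_C,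
    Polynomial.coeff_iterate_derivative, zero_add, Nat.descFactorial_self, map_nsmul] at hlead
  simp [Nat.factorial_ne_zero, hQ] at hlead

theorem derivation_eq_zero_of_isAlgebraic_adjoin [IsScalarTower A B M] (D : Derivation A B M)
    {S : Set B} (hS : ∀ s ∈ S, D s = 0) {x : B} (hx : IsAlgebraic (Algebra.adjoin A S) x) :
    D x = 0 := by
  have hconst : Set.EqOn D (0 : Derivation A B M) (Algebra.adjoin A S) :=
    Derivation.eqOn_adjoin hS
  let D' : Derivation (Algebra.adjoin A S) B M :=
    Derivation.mk'
      { toFun := D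
        map_add' := map_add D
        map_smul' := fun a b => by
          rw [Algebra.smul_def, D.leibniz, show D (algebraMap _ B a) = 0 from hconst a.2,
            smul_zero, add_zero, algebraMap_smul]
          rfl }
      D.leibniz
  exact derivation_eq_zero_of_isAlgebraic D' hx

end Derivation

theorem frequently_nhds_pi {ι : Type*} {X : ι → Type*} [∀ i, TopologicalSpace (X i)]
    {x : ∀ i, X i} {j : ι} {P : X j → Prop} (hP : ∃ᶠ b in 𝓝 (x j), P b) :
    ∃ᶠ y in 𝓝 x, (∀ i ≠ j, y i = x i) ∧ P (y j) := by
  classical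
  have hcont : Tendsto (Function.update x j) (𝓝 (x j)) (𝓝 x) := by
    simpa using (Continuous.update (f := fun _ => x) continuous_const j continuous_id).tendsto (x j)
  refine hcont.frequently (hP.mono fun b hb => ⟨fun i hi => Function.update_of_ne hi .., ?_⟩)
  rwa [Function.update_self]

section Fibre

variable {σ k K : Type*} [CommRing k] [CommRing K] [IsDomain K] [Algebra k K]

theorem finite_aeval_image_fibre {p : σ → K} (hp : AlgebraicIndependent k p)
    {S : Set (MvPolynomial σ k)} {h : MvPolynomial σ k} (hh : IsAlgebraic (Algebra.adjoin k S) h) :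
    ((fun q : σ → K => aeval q h) '' {q | ∀ s ∈ S, aeval q s = aeval p s}).Finite := by
  obtain ⟨Q, hQ, hQh⟩ := hh
  let eval (q : σ → K) : Algebra.adjoin k S →+* K :=
    ((aeval q).comp (Algebra.adjoin k S).val : Algebra.adjoin k S →ₐ[k] K)
  have eval_injective : Function.Injective (eval p) :=
    (algebraicIndependent_iff_injective_aeval.1 hp).comp Subtype.val_injective
  refine (Polynomial.finite_setOfPred_isRoot
    ((Polynomial.map_ne_zero_iff eval_injective).2 hQ)).subset ?_
  rintro _ ⟨q, hq, rfl⟩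
  have eval_eq : eval q = eval p :=
    RingHom.ext fun a => AlgHom.eqOn_adjoin_iff (φ := aeval q) (ψ := aeval p) |>.2 hq a.2
  have hroot : Polynomial.eval₂ (eval q) (aeval q h) Q = 0 := by
    have := congrArg (aeval q : MvPolynomial σ k →ₐ[k] K).toRingHom hQh
    rwa [Polynomial.aeval_def, Polynomial.hom_eval₂, map_zero] at this
  change Polynomial.eval _ _ = 0
  rwa [← eval_eq, Polynomial.eval_map]

end Fibre

section Jacobian

variable {σ ι k K : Type*} [CommRing k] [CommRing K] [Algebra k K]

/-- The Jacobian matrix at `p` of the polynomial map with components `f j`. -/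
noncomputable def jacobian (f : ι → MvPolynomial σ k) (p : σ → K) : Matrix ι σ K :=
  Matrix.of fun j i => aeval p (pderiv i (f j))

variable [Fintype σ] [IsDomain K] [CharZero K]

theorem sum_pderiv_mul_eq_zero_of_isAlgebraic {p w : σ → K} (hp : AlgebraicIndependent k p)
    {S : Set (MvPolynomial σ k)} (hS : ∀ s ∈ S, ∑ i, aeval p (pderiv i s) * w i = 0)
    {h : MvPolynomial σ k} (hh : IsAlgebraic (Algebra.adjoin k S) h) :
    ∑ i, aeval p (pderiv i h) * w i = 0 := by
  let : Algebra (MvPolynomial σ k) K := (aeval p).toAlgebra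
  have : IsScalarTower k (MvPolynomial σ k) K := .of_algHom (aeval p)
  have aeval_injective : Function.Injective (algebraMap (MvPolynomial σ k) K) :=
    algebraicIndependent_iff_injective_aeval.1 hp
  have : FaithfulSMul (MvPolynomial σ k) K :=
    (faithfulSMul_iff_algebraMap_injective _ _).2 aeval_injective
  have : IsDomain (MvPolynomial σ k) := aeval_injective.isDomain
  have : CharZero (MvPolynomial σ k) := (algebraMap (MvPolynomial σ k) K).charZero
  let D : Derivation k (MvPolynomial σ k) K :=
    ∑ i, w i • (Algebra.linearMap (MvPolynomial σ k) K).compDer (pderiv i)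
  have D_apply (f : MvPolynomial σ k) : D f = ∑ i, aeval p (pderiv i f) * w i := by
    let coe : Derivation k (MvPolynomial σ k) K →+ (MvPolynomial σ k → K) :=
      Derivation.coeFnAddMonoidHom
    refine (congrFun (map_sum coe _ _) f).trans ?_
    rw [Finset.sum_apply]
    exact Finset.sum_congr rfl fun i _ => mul_comm _ _
  rw [← D_apply]
  exact derivation_eq_zero_of_isAlgebraic_adjoin D (fun s hs => (D_apply s).trans (hS s hs)) hh

theorem jacobian_mulVec_injective {p : σ → K} (hp : AlgebraicIndependent k p)
    {f : ι → MvPolynomial σ k} (hf : IsTranscendenceBasis k f) :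
    Function.Injective (jacobian f p).mulVec := by
  classical
  have : Nontrivial k := (algebraMap k K).domain_nontrivial
  refine (injective_iff_map_eq_zero (jacobian f p).mulVecLin).2 fun w hw => funext fun i => ?_
  have hS : ∀ s ∈ Set.range f, ∑ i, aeval p (pderiv i s) * w i = 0 :=
    Set.forall_mem_range.2 (congrFun hw)
  simpa [Pi.single_apply] using
    sum_pderiv_mul_eq_zero_of_isAlgebraic hp hS (hf.isAlgebraic.isAlgebraic (X i))

end Jacobian

section Deformation

variable {σ ι k 𝕜 : Type*} [CommRing k] [NontriviallyNormedField 𝕜] [Algebra k 𝕜]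

theorem hasStrictFDerivAt_aeval [Fintype σ] (p : σ → 𝕜) (h : MvPolynomial σ k) :
    HasStrictFDerivAt (fun x : σ → 𝕜 => aeval x h)
      (∑ i, aeval p (pderiv i h) • ContinuousLinearMap.proj (R := 𝕜) (φ := fun _ : σ => 𝕜) i)
      p := by
  classical
  induction h using MvPolynomial.induction_on with
  | C a =>
    simp only [aeval_C]
    refine (hasStrictFDerivAt_const (𝕜 := 𝕜) (algebraMap k 𝕜 a) p).congr_fderiv ?_
    ext w
    simp
  | add f g hf hg =>
    simp only [map_add]
    refine (hf.fun_add hg).congr_fderiv ?_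
    ext w
    simp [add_mul, Finset.sum_add_distrib]
  | mul_X f j hf =>
    simp only [map_mul, aeval_X]
    refine (hf.mul (hasStrictFDerivAt_apply j p)).congr_fderiv ?_
    ext w
    simp [Pi.single_apply, add_mul, Finset.sum_add_distrib, Finset.mul_sum, mul_assoc, apply_ite]

theorem hasStrictFDerivAt_aeval_pi [CompleteSpace 𝕜] [Fintype σ] [Finite ι]
    (f : ι → MvPolynomial σ k) (p : σ → 𝕜) :
    HasStrictFDerivAt (fun (x : σ → 𝕜) j => aeval x (f j))
      (jacobian f p).mulVecLin.toContinuousLinearMap p := by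
  have := Fintype.ofFinite ι
  refine hasStrictFDerivAt_pi'.2 fun j => (hasStrictFDerivAt_aeval p (f j)).congr_fderiv ?_
  ext w
  simp [jacobian, Matrix.mulVec, dotProduct]

variable [Finite σ] {p : σ → 𝕜}

theorem eventually_aeval_eq_of_isAlgebraic (hp : AlgebraicIndependent k p)
    {S : Set (MvPolynomial σ k)} {h : MvPolynomial σ k} (hh : IsAlgebraic (Algebra.adjoin k S) h) :
    ∀ᶠ q in 𝓝 p, (∀ s ∈ S, aeval q s = aeval p s) → aeval q h = aeval p h := by
  have := Fintype.ofFinite σ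
  have hcont : ContinuousAt (fun q : σ → 𝕜 => aeval q h) p :=
    (hasStrictFDerivAt_aeval p h).continuousAt
  have hclosed := (finite_aeval_image_fibre hp hh).sdiff (t := {aeval p h}) |>.isClosed
  filter_upwards [hcont.preimage_mem_nhds (hclosed.isOpen_compl.mem_nhds fun hmem => hmem.2 rfl)]
    with q hq hqS
  by_contra hne
  exact hq ⟨⟨q, hqS, rfl⟩, hne⟩

variable [CompleteSpace 𝕜] [CharZero 𝕜]

theorem map_aeval_nhds_of_isTranscendenceBasis (hp : AlgebraicIndependent k p)
    {f : ι → MvPolynomial σ k} (hf : IsTranscendenceBasis k f) :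
    map (fun (x : σ → 𝕜) j => aeval x (f j)) (𝓝 p) = 𝓝 fun j => aeval p (f j) := by
  have := Fintype.ofFinite σ
  have : Nontrivial k := (algebraMap k 𝕜).domain_nontrivial
  have : IsDomain (MvPolynomial σ k) := (algebraicIndependent_iff_injective_aeval.1 hp).isDomain
  have hcard := (IsTranscendenceBasis.mvPolynomial σ k).lift_cardinalMk_eq hf
  have : Finite ι := by
    rw [← Cardinal.mk_lt_aleph0_iff, ← Cardinal.lift_lt_aleph0, ← hcard, Cardinal.lift_lt_aleph0]
    exact Cardinal.mk_lt_aleph0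
  have := Fintype.ofFinite ι
  have hrank : Module.finrank 𝕜 (σ → 𝕜) = Module.finrank 𝕜 (ι → 𝕜) := by
    simpa [Nat.card_eq_fintype_card] using congrArg Cardinal.toNat hcard
  exact (hasStrictFDerivAt_aeval_pi f p).map_nhds_eq_of_surj <| LinearMap.range_eq_top.2 <|
    (LinearMap.injective_iff_surjective_of_finrank_eq_finrank hrank).1
      (jacobian_mulVec_injective hp hf)

theorem frequently_aeval_ne_of_isTranscendenceBasis (hp : AlgebraicIndependent k p)
    {f : ι → MvPolynomial σ k} (hf : IsTranscendenceBasis k f) (j : ι) :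
    ∃ᶠ q in 𝓝 p, (∀ i ≠ j, aeval q (f i) = aeval p (f i)) ∧ aeval q (f j) ≠ aeval p (f j) := by
  have hne : ∃ᶠ b in 𝓝 (aeval p (f j)), b ≠ aeval p (f j) :=
    frequently_iff_neBot.2 (NormedField.nhdsNE_neBot _)
  have := frequently_nhds_pi (x := fun i => aeval p (f i)) hne
  rwa [← map_aeval_nhds_of_isTranscendenceBasis hp hf, frequently_map] at this

theorem isAlgebraic_of_eventually_aeval_eq (hp : AlgebraicIndependent k p)
    {S : Set (MvPolynomial σ k)} (hS : S.Finite) {h : MvPolynomial σ k}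
    (hh : ∀ᶠ q in 𝓝 p, (∀ s ∈ S, aeval q s = aeval p s) → aeval q h = aeval p h) :
    IsAlgebraic (Algebra.adjoin k S) h := by
  have : IsDomain (MvPolynomial σ k) := (algebraicIndependent_iff_injective_aeval.1 hp).isDomain
  obtain ⟨B, hB⟩ := (AlgebraicIndependent.matroid k (MvPolynomial σ k)).exists_isBasis S
  obtain ⟨hBind, -, hSB⟩ := AlgebraicIndependent.matroid_isBasis_iff.1 hB
  rw [← AlgebraicIndependent.isAlgebraic_adjoin_iff_of_matroid_isBasis hB]
  by_contra hh_transcendental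
  obtain ⟨T, hBT, hT⟩ := exists_isTranscendenceBasis_superset
    (hBind.insert (i := h) (by rwa [Set.image_id]))
  have hhB : h ∉ B := fun hmem => hh_transcendental
    (isAlgebraic_algebraMap (⟨h, Algebra.subset_adjoin hmem⟩ : Algebra.adjoin k B))
  have hSnear : ∀ᶠ q in 𝓝 p, ∀ s ∈ S, (∀ b ∈ B, aeval q b = aeval p b) → aeval q s = aeval p s :=
    (eventually_all_finite hS).2 fun s hs => eventually_aeval_eq_of_isAlgebraic hp (hSB s hs)
  obtain ⟨q, ⟨hqT, hqh⟩, hqS, hq⟩ := ((frequently_aeval_ne_of_isTranscendenceBasis hp hT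
    ⟨h, hBT (Set.mem_insert h B)⟩).and_eventually (hSnear.and hh)).exists
  have hqB : ∀ b ∈ B, aeval q b = aeval p b := fun b hb =>
    hqT ⟨b, hBT (Set.mem_insert_of_mem h hb)⟩ fun hbh => hhB (Subtype.mk.inj hbh ▸ hb)
  exact hqh (hq fun s hs => hqS s hs hqB)

end Deformation

section GenericExtension

variable {ι k 𝕜 : Type*} [CommRing k] [Countable k] [NontriviallyNormedField 𝕜] [CompleteSpace 𝕜]
  [Algebra k 𝕜] {x : ι → 𝕜} {s : Set ι}

theorem dense_setOf_transcendental_adjoin {S : Set 𝕜} (hS : S.Countable) :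
    Dense {y : 𝕜 | Transcendental (Algebra.adjoin k S) y} := by
  have : Countable (Algebra.adjoin k S) := by
    rw [← Cardinal.mk_le_aleph0_iff, ← Cardinal.lift_le_aleph0]
    exact (Algebra.lift_cardinalMk_adjoin_le k S).trans (by simp [hS.le_aleph0])
  exact (Algebraic.countable (Algebra.adjoin k S) 𝕜).dense_compl 𝕜

theorem frequently_algebraicIndepOn_insert (hs : AlgebraicIndepOn k x s)
    (hs_countable : s.Countable) (a : ι) :
    ∃ᶠ y in 𝓝 x, Set.EqOn y x s ∧ AlgebraicIndepOn k y (insert a s) := by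
  by_cases ha : a ∈ s
  · rw [Set.insert_eq_of_mem ha]
    exact (frequently_pure.2 ⟨Set.eqOn_refl x s, hs⟩).filter_mono (pure_le_nhds x)
  have htr := mem_closure_iff_frequently.1
    (dense_setOf_transcendental_adjoin (k := k) (hs_countable.image x) (x a))
  refine (frequently_nhds_pi htr).mono fun y ⟨hy, hya⟩ => ?_
  have hyx : Set.EqOn y x s := fun i hi => hy i (ne_of_mem_of_not_mem hi ha)
  refine ⟨hyx, AlgebraicIndepOn.insert ?_ ?_⟩
  · rwa [AlgebraicIndepOn, show (fun i : s => y i) = fun i : s => x i from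
      funext fun i => hyx i.2]
  · rwa [hyx.image_eq]

theorem frequently_algebraicIndependent [Finite ι] (hs : AlgebraicIndepOn k x s) :
    ∃ᶠ y in 𝓝 x, Set.EqOn y x s ∧ AlgebraicIndependent k y := by
  have extend (t : Set ι) : ∃ᶠ y in 𝓝 x, Set.EqOn y x s ∧ AlgebraicIndepOn k y (s ∪ t) := by
    induction t, t.toFinite using Set.Finite.induction_on with
    | empty =>
      rw [Set.union_empty]
      exact (frequently_pure.2 ⟨Set.eqOn_refl x s, hs⟩).filter_mono (pure_le_nhds x)
    | @insert a t _ _ ih =>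
      rw [Set.union_insert]
      refine frequently_frequently_nhds.1 (ih.mono fun y ⟨hyx, hy⟩ => ?_)
      refine (frequently_algebraicIndepOn_insert hy (Set.to_countable _) a).mono fun z hz => ?_
      exact ⟨fun i hi => (hz.1 (.inl hi)).trans (hyx hi), hz.2⟩
  refine (extend Set.univ).mono fun y hy => ⟨hy.1, ?_⟩
  exact AlgebraicIndepOn.univ.1 (Set.union_univ s ▸ hy.2)

end GenericExtension

section DistanceMap

variable {ι V E : Type*} [Finite V] [NormedAddCommGroup E] [NormedSpace ℝ E]
  [FiniteDimensional ℝ E]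

theorem isClosed_range_norm_sub (a b : ι → V) :
    IsClosed (Set.range fun (q : V → E) (i : ι) => ‖q (a i) - q (b i)‖) := by
  let diff : (V → E) →ₗ[ℝ] ι → E :=
    LinearMap.pi fun i => .proj (R := ℝ) (φ := fun _ : V => E) (a i) - .proj (b i)
  have norm_proper : IsProperMap fun (w : ι → E) i => ‖w i‖ :=
    .pi_map fun _ => by simpa using isProperMap_dist (0 : E)
  have range_diff_closed : IsClosed (LinearMap.range diff : Set (ι → E)) :=
    Submodule.closed_of_finiteDimensional _
  convert! norm_proper.isClosedMap _ range_diff_closed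
  rw [LinearMap.coe_range, ← Set.range_comp]
  rfl
end DistanceMap

section Frameworks

variable {V W : Type*} {d : ℕ} {G : SimpleGraph V} {p : Config V d} {u v : V}

/-- The list of all vertex coordinates, identifying `d`-dimensional configurations of `V` with
points of `ℝ^(V × Fin d)`; `Generic p` says that `coords p` is algebraically independent. -/
def coords : Config V d ≃ₜ (V × Fin d → ℝ) where
  toFun p c := p c.1 c.2
  invFun x a := WithLp.toLp 2 fun i => x (a, i)
  left_inv _ := rfl
  right_inv _ := rfl
  continuous_toFun := by fun_prop
  continuous_invFun := by fun_prop

theorem Generic.comp (hp : Generic p) {f : W → V} (hf : Function.Injective f) :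
    Generic fun a => p (f a) :=
  AlgebraicIndependent.comp hp (Prod.map f id) (hf.prodMap Function.injective_id)

theorem frequently_generic [Finite V] {X : Set V} (hp : Generic fun a : X => p a) :
    ∃ᶠ q in 𝓝 p, Set.EqOn q p X ∧ Generic q := by
  have hX : AlgebraicIndepOn ℚ (coords p) (Prod.fst ⁻¹' X) :=
    AlgebraicIndependent.comp hp
      (fun c : Prod.fst ⁻¹' X => ((⟨c.1.1, c.2⟩ : X), c.1.2))
      fun c c' h => by simpa [Subtype.ext_iff, Prod.ext_iff] using h
  have := frequently_algebraicIndependent hX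
  rw [← coords.map_nhds_eq p, frequently_map] at this
  exact this.mono fun q hq =>
    ⟨fun a ha => PiLp.ext fun i => hq.1 (show (a, i) ∈ Prod.fst ⁻¹' X from ha), hq.2⟩

theorem RigidFramework.eventually_congruent [Finite V] (h : RigidFramework G p) :
    ∀ᶠ q in 𝓝 p, Equivalent G p q → Congruent p q := by
  obtain ⟨ε, hε, hcongr⟩ := h
  have hnear : ∀ᶠ q in 𝓝 p, ∀ x, ‖p x - q x‖ < ε := eventually_all.2 fun x => by
    have hcont : Continuous fun q : Config V d => ‖p x - q x‖ := by fun_prop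
    exact hcont.continuousAt.eventually_lt continuousAt_const (by simpa using hε)
  exact hnear.mono fun q hq hequiv => hcongr q hequiv hq

/-- The squared distance of the vertices `a` and `b`, as a polynomial in the coordinates. -/
noncomputable def sqDist (d : ℕ) (a b : V) : MvPolynomial (V × Fin d) ℚ :=
  ∑ i, (X (a, i) - X (b, i)) ^ 2

theorem aeval_sqDist (p : Config V d) (a b : V) :
    aeval (coords p) (sqDist d a b) = ‖p a - p b‖ ^ 2 := by
  simp [sqDist, coords, EuclideanSpace.norm_sq_eq]

theorem aeval_sqDist_eq_iff {q : Config V d} {a b : V} :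
    aeval (coords q) (sqDist d a b) = aeval (coords p) (sqDist d a b) ↔
      ‖p a - p b‖ = ‖q a - q b‖ := by
  rw [aeval_sqDist, aeval_sqDist, sq_eq_sq₀ (norm_nonneg _) (norm_nonneg _), eq_comm]

/-- The squared edge lengths of `G`, as polynomials in the coordinates. -/
def edgePolynomials (d : ℕ) (G : SimpleGraph V) : Set (MvPolynomial (V × Fin d) ℚ) :=
  {s | ∃ x y, G.Adj x y ∧ sqDist d x y = s}

theorem finite_edgePolynomials [Finite V] (d : ℕ) (G : SimpleGraph V) :
    (edgePolynomials d G).Finite :=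
  (Set.finite_range fun e : V × V => sqDist d e.1 e.2).subset
    fun _ ⟨x, y, _, hs⟩ => ⟨(x, y), hs⟩

theorem equivalent_iff_forall_aeval_eq {q : Config V d} :
    Equivalent G p q ↔ ∀ s ∈ edgePolynomials d G, aeval (coords q) s = aeval (coords p) s := by
  constructor
  · rintro h _ ⟨x, y, hxy, rfl⟩
    exact aeval_sqDist_eq_iff.2 (h x y hxy)
  · exact fun h x y hxy => aeval_sqDist_eq_iff.1 (h _ ⟨x, y, hxy, rfl⟩)

theorem RigidFramework.finite_norm_sub_image [Finite V] (h : RigidFramework G p) (hp : Generic p)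
    (u v : V) : ((fun q : Config V d => ‖q u - q v‖) '' {q | Equivalent G p q}).Finite := by
  have sqDist_near : ∀ᶠ x in 𝓝 (coords p),
      (∀ s ∈ edgePolynomials d G, aeval x s = aeval (coords p) s) →
        aeval x (sqDist d u v) = aeval (coords p) (sqDist d u v) := by
    rw [← coords.map_nhds_eq p, eventually_map]
    exact h.eventually_congruent.mono fun q hq hqs =>
      aeval_sqDist_eq_iff.2 (hq (equivalent_iff_forall_aeval_eq.2 hqs) u v)
  have sqDist_algebraic :=
    isAlgebraic_of_eventually_aeval_eq hp (finite_edgePolynomials d G) sqDist_near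
  refine ((finite_aeval_image_fibre hp sqDist_algebraic).image Real.sqrt).subset ?_
  rintro _ ⟨q, hq, rfl⟩
  refine ⟨_, ⟨coords q, equivalent_iff_forall_aeval_eq.1 hq, rfl⟩, ?_⟩
  beta_reduce
  rw [aeval_sqDist, Real.sqrt_sq (norm_nonneg _)]

theorem isClosed_setOf_exists_equivalent [Finite V] (G : SimpleGraph V) (u v : V) (c : ℝ) :
    IsClosed {p : Config V d | ∃ q, Equivalent G p q ∧ ‖q u - q v‖ = c} := by
  let endpoints : Option {e : V × V // G.Adj e.1 e.2} → V × V := fun e => e.elim (u, v) (↑)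
  let lengths (p : Config V d) : Option {e : V × V // G.Adj e.1 e.2} → ℝ :=
    fun e => e.elim c fun e => ‖p e.1.1 - p e.1.2‖
  have lengths_continuous : Continuous lengths :=
    continuous_pi fun e => by cases e <;> simp only [lengths, Option.elim] <;> fun_prop
  convert! (isClosed_range_norm_sub (E := EuclideanSpace ℝ (Fin d)) (fun e => (endpoints e).1)
    fun e => (endpoints e).2).preimage lengths_continuous
  ext p
  refine exists_congr fun q => ?_
  simp [funext_iff, Option.forall, lengths, endpoints, Equivalent, and_comm, eq_comm]

theorem GloballyLinkedIn.weaklyGloballyLinked [Finite V] {V₀ : Set V}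
    (h : GloballyLinkedIn G p u v) (hp : Generic fun a : V₀ => p a)
    (hrigid : RigidFramework (G.induce V₀) fun a => p a) (hu : u ∈ V₀) (hv : v ∈ V₀) :
    WeaklyGloballyLinked d G u v := by
  let realizable : Set ℝ := (fun q : Config V₀ d => ‖q ⟨u, hu⟩ - q ⟨v, hv⟩‖) ''
    {q | Equivalent (G.induce V₀) (fun a => p a) q}
  have realizable_finite : realizable.Finite :=
    hrigid.finite_norm_sub_image hp ⟨u, hu⟩ ⟨v, hv⟩
  have other_lengths_far : ∀ᶠ p' in 𝓝 p, ∀ c ∈ realizable \ {‖p u - p v‖},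
      ¬ ∃ q, Equivalent G p' q ∧ ‖q u - q v‖ = c := by
    refine (eventually_all_finite realizable_finite.sdiff).2 fun c hc => ?_
    refine (isClosed_setOf_exists_equivalent G u v c).isOpen_compl.mem_nhds ?_
    rintro ⟨q, hq, hqc⟩
    exact hc.2 (hqc.symm.trans (h q hq).symm)
  obtain ⟨p', ⟨hp'p, hp'⟩, hfar⟩ :=
    ((frequently_generic hp).and_eventually other_lengths_far).exists
  refine ⟨p', hp', fun q hq => ?_⟩
  have hq_realizable : ‖q u - q v‖ ∈ realizable := by
    refine ⟨fun a => q a, fun x y hxy => ?_, rfl⟩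
    simpa only [hp'p x.2, hp'p y.2] using hq x y hxy
  rw [hp'p hu, hp'p hv]
  by_contra hne
  exact hfar _ ⟨hq_realizable, Ne.symm hne⟩ ⟨q, hq, rfl⟩

end Frameworks

section Contraction

variable {V : Type*} {d : ℕ} {G : SimpleGraph V} {S : Set V} {u v : V}

theorem injOn_contractMk {X : Set V} (hX : (S ∩ X).Subsingleton) :
    Set.InjOn (contractMk S) X := fun _ ha _ hb hab =>
  (Quotient.exact hab).elim id fun h => hX ⟨h.1, ha⟩ ⟨h.2, hb⟩

theorem GloballyLinkedIn.of_contract (hS : (G.induce S).Preconnected)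
    {p : Config (ContractVertex S) d}
    (h : GloballyLinkedIn (contract G S) p (contractMk S u) (contractMk S v)) :
    GloballyLinkedIn G (fun x => p (contractMk S x)) u v := by
  intro q hq
  have eq_of_adj {a b : S} (hab : (G.induce S).Adj a b) : q a = q b := by
    have hmk : contractMk S a = contractMk S b := Quotient.sound (.inr ⟨a.2, b.2⟩)
    simpa [hmk, sub_eq_zero] using (hq a b hab).symm
  have eq_of_walk {a b : S} (w : (G.induce S).Walk a b) : q a = q b := by
    induction w with
    | nil => rfl
    | cons hab _ ih => exact (eq_of_adj hab).trans ih
  let q' : Config (ContractVertex S) d := Quotient.lift q (by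
    rintro a b (rfl | ⟨ha, hb⟩)
    · rfl
    · exact (hS ⟨a, ha⟩ ⟨b, hb⟩).elim eq_of_walk)
  refine h q' ?_
  rintro _ _ ⟨-, x, y, hxy, rfl, rfl⟩
  exact hq x y hxy

end Contraction

end GraphRigidity

theorem mainTheorem5_general {V : Type*} [Finite V] (d : ℕ) (G : SimpleGraph V) (u v : V)
    (V₀ S : Set V) (hV₀ : GraphRigidity.PairRigid d G V₀ u v) (hS : (G.induce S).Preconnected)
    (hSV₀ : (S ∩ V₀).Subsingleton)
    (hlinked : GraphRigidity.WeaklyGloballyLinked d (GraphRigidity.contract G S)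
      (GraphRigidity.contractMk S u) (GraphRigidity.contractMk S v)) :
    GraphRigidity.WeaklyGloballyLinked d G u v := by
  obtain ⟨p, hp, hlink⟩ := hlinked
  have hpV₀ : GraphRigidity.Generic fun a : V₀ => p (GraphRigidity.contractMk S a) :=
    hp.comp (GraphRigidity.injOn_contractMk hSV₀).injective
  obtain ⟨hrigid, hu, hv⟩ := hV₀
  exact (hlink.of_contract hS).weaklyGloballyLinked hpV₀ (hrigid _ hpV₀) hu hv

theorem mainTheorem5 {V : Type*} [Finite V] (d : ℕ) (hd : 1 ≤ d)
    (G : SimpleGraph V) (u v : V) (V₀ : Set V)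
    (hV₀ : GraphRigidity.PairRigid d G V₀ u v)
    (s₁ s₂ : V) (he : G.Adj s₁ s₂) (heV₀ : ¬ (s₁ ∈ V₀ ∧ s₂ ∈ V₀))
    (hlinked : GraphRigidity.WeaklyGloballyLinked d
      (GraphRigidity.contract G {s₁, s₂})
      (GraphRigidity.contractMk {s₁, s₂} u) (GraphRigidity.contractMk {s₁, s₂} v)) :
    GraphRigidity.WeaklyGloballyLinked d G u v := by
  refine mainTheorem5_general d G u v V₀ {s₁, s₂} hV₀
    (SimpleGraph.induce_pair_connected_of_adj he).preconnected ?_ hlinked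
  grind [Set.Subsingleton]
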